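/- Let $f_i:\mathbb R^{n_i}\to\mathbb R\cup\{+\infty\}$ be proper, closed and convex and let $\mathcal X_i\subseteq\mathbb R^{n_i}$ be nonempty, closed and convex ($i=1,2$). Put $f(\mathbf x)=f_1(\mathbf x_1)+f_2(\mathbf x_2)$, $\mathcal X=\mathcal X_1\times\mathcal X_2$, $\mathbf A\mathbf x=\mathbf A_1\mathbf x_1+\mathbf A_2\mathbf x_2$ with matrices $\mathbf A_i\in\mathbb R^{m\times n_i}$, and $\mathbf b\in\mathbb R^m$. Consider $$f^\star=\min\{f(\mathbf x):\mathbf x\in\mathcal X,\ \mathbf A\mathbf x=\mathbf b\},\qquad g(\mathbf y)=\inf_{\mathbf x\in\mathcal X}\{f(\mathbf x)+\mathbf y^T(\mathbf A\mathbf x-\mathbf b)\},\qquad g^\star=\sup_{\mathbf y\in\mathbb R^m}g(\mathbf y),$$ and let $\mathcal Y^\star$ be the set of maximizers of $g$. Assume that the minimum $f^\star$ is attained and finite, that $\sup_{\mathbf x\in\mathcal X}\|\mathbf A\mathbf x-\mathbf b\|_2<\infty$, and that at least one of the following holds: (a) $\mathcal X$ is a polytope and some $\mathbf x\in\mathcal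 X\cap\mathrm{relint}(\mathrm{dom} f)$ satisfies $\mathbf A\mathbf x=\mathbf b$; (b) some $\mathbf x\in\mathrm{relint}(\mathcal X\cap\mathrm{dom} f)$ satisfies $\mathbf A\mathbf x=\mathbf b$. (If $f$ is finite everywhere, this says that $\mathcal X$ is a polytope or that $\{\mathbf A\mathbf x=\mathbf b\}$ meets $\mathrm{relint}(\mathcal X)$.) Let $\gamma_0=3$ and, for $k\ge0$, $$\tau_k=\tfrac{3}{k+4},\quad \gamma_k=\tfrac{2\gamma_0}{k+2},\quad \beta_k=\tfrac{9(k+3)}{\gamma_0(k+1)(k+7)},\quad \rho_k=\tfrac{3\gamma_0}{(k+3)(k+4)},\quad \eta_k=\tfrac{\gamma_0}{k+3}.$$ Fix $\bar{\mathbf x}_1^c\in\mathcal X_1$. A block step at index $k$ from $(\hat{\mathbf y},\mathbf z_2)$ produces $\mathbf x=(\mathbf x_1,\mathbf x_2)$ and $\mathbf y$ with $$\begin{aligned} \mathbf x_1&\in\arg\min_{\mathbf u_1\in\mathcal X_1}\Big\{f_1(\mathbf u_1)+\tfrac{\gamma_{k+1}}2\|\mathbf A_1(\mathbf u_1-\bar{\mathbf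 x}_1^c)\|_2^2+\tfrac{\rho_k}2\|\mathbf A_1\mathbf u_1+\mathbf A_2\mathbf z_2-\mathbf b+\rho_k^{-1}\hat{\mathbf y}\|_2^2\Big\},\\ \mathbf x_2&\in\arg\min_{\mathbf u_2\in\mathcal X_2}\Big\{f_2(\mathbf u_2)+\tfrac{\eta_k}2\|\mathbf A_1\mathbf x_1+\mathbf A_2\mathbf u_2-\mathbf b+\eta_k^{-1}\hat{\mathbf y}\|_2^2\Big\},\\ \mathbf y&=\hat{\mathbf y}+\eta_k(\mathbf A\mathbf x-\mathbf b). \end{aligned}$$ Let $(\bar{\mathbf x}^0,\bar{\mathbf y}^0)$ be produced by a block step at index $0$ from $(\mathbf 0,\mathbf z_2)$ for some $\mathbf z_2\in\mathcal X_2$, let $\mathbf x_2^0\in\mathcal X_2$, and for $k\ge0$ let $$\hat{\mathbf y}^k=(1-\tau_k)\bar{\mathbf y}^k+\tau_k\beta_k^{-1}(\mathbf A\bar{\mathbf x}^k-\mathbf b),\qquad \bar{\mathbf x}^{k+1}=(1-\tau_k)\bar{\mathbf x}^k+\tau_k\mathbf x^{k+1},$$ where $(\mathbf x^{k+1},\bar{\mathbf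 y}^{k+1})$ is produced by a block step at index $k$ from $(\hat{\mathbf y}^k,\mathbf x_2^k)$. Put $D^1_{\mathcal X_1}=\frac12\sup_{\mathbf x_1\in\mathcal X_1}\|\mathbf A_1(\mathbf x_1-\bar{\mathbf x}_1^c)\|_2^2$ and $D^{\mathbf A}_{\mathcal X}=\frac12\sup_{\mathbf x\in\mathcal X}\|\mathbf A\mathbf x-\mathbf b\|_2^2$. Then $D_{\mathcal Y^\star}:=\min\{\|\mathbf y\|_2:\mathbf y\in\mathcal Y^\star\}$ exists and, with $$D_{\max}=\max\Big\{D^1_{\mathcal X_1}+3D^{\mathbf A}_{\mathcal X},\ D_{\mathcal Y^\star}\Big(D_{\mathcal Y^\star}+\sqrt{D^1_{\mathcal X_1}+4D^{\mathbf A}_{\mathcal X}}\Big)\Big\},$$ for all $k\ge0$ $$|f(\bar{\mathbf x}^k)-f^\star|\le\frac{6D_{\max}}{k+2},\qquad \|\mathbf A\bar{\mathbf x}^k-\mathbf b\|_2\le\frac{6\Big[D_{\mathcal Y^\star}+\sqrt{D^1_{\mathcal X_1}+4D^{\mathbf A}_{\mathcal X}}\Big]}{k+2}.$$ Consequently an $\varepsilon$-primal-dual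 solution is reached in $O(\varepsilon^{-1})$ iterations: for every $\varepsilon>0$ and every $k$ with $$k+2\ \ge\ \frac{12}{\varepsilon}\max\Big\{D_{\max},\ D_{\mathcal Y^\star}+\sqrt{D^1_{\mathcal X_1}+4D^{\mathbf A}_{\mathcal X}}\Big\}$$ one has $\bar{\mathbf x}^k\in\mathcal X$, $|f(\bar{\mathbf x}^k)-f^\star|\le\varepsilon$, $\|\mathbf A\bar{\mathbf x}^k-\mathbf b\|_2\le\varepsilon$ and $|g(\bar{\mathbf y}^k)-g^\star|\le\varepsilon$. -/

import Mathlib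

namespace PADMM

/-- Euclidean space of dimension `n`. -/
abbrev Vec (n : ℕ) := EuclideanSpace ℝ (Fin n)

/-- A proper, closed (lower semicontinuous), convex function with values in `ℝ ∪ {+∞}`. -/
structure ProperClosedConvex {n : ℕ} (f : Vec n → EReal) : Prop where
  ne_bot : ∀ x, f x ≠ ⊥
  exists_ne_top : ∃ x, f x ≠ ⊤
  closed : LowerSemicontinuous f
  convex : Convex ℝ {p : Vec n × ℝ | f p.1 ≤ (p.2 : EReal)}

/-- The data of a two-block problem: minimize `f₁ x₁ + f₂ x₂` over `x₁ ∈ X₁`, `x₂ ∈ X₂`,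
subject to `A₁ x₁ + A₂ x₂ = b`. -/
structure Problem (n₁ n₂ m : ℕ) where
  f₁ : Vec n₁ → EReal
  f₂ : Vec n₂ → EReal
  X₁ : Set (Vec n₁)
  X₂ : Set (Vec n₂)
  A₁ : Vec n₁ →L[ℝ] Vec m
  A₂ : Vec n₂ →L[ℝ] Vec m
  b : Vec m

namespace Problem

variable {n₁ n₂ m : ℕ} (P : Problem n₁ n₂ m)

/-- The objective `f`. -/
noncomputable def obj (x : Vec n₁ × Vec n₂) : EReal := P.f₁ x.1 + P.f₂ x.2

/-- The set `X = X₁ × X₂`. -/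
def X : Set (Vec n₁ × Vec n₂) := P.X₁ ×ˢ P.X₂

/-- The effective domain of `f`. -/
def dom : Set (Vec n₁ × Vec n₂) := {x | P.f₁ x.1 ≠ ⊤ ∧ P.f₂ x.2 ≠ ⊤}

/-- The residual `A x - b`. -/
def res (x : Vec n₁ × Vec n₂) : Vec m := P.A₁ x.1 + P.A₂ x.2 - P.b

/-- The feasible points: `x ∈ X` with `A x = b`. -/
def feasible : Set (Vec n₁ × Vec n₂) := {x | x ∈ P.X ∧ P.res x = 0}

/-- The optimal value `f*`. -/
noncomputable def optVal : EReal := ⨅ x ∈ P.feasible, P.obj x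

/-- The primal solution set `X*`. -/
def primalSolutions : Set (Vec n₁ × Vec n₂) :=
  {x | x ∈ P.feasible ∧ P.obj x ≠ ⊤ ∧ ∀ z ∈ P.feasible, P.obj x ≤ P.obj z}

/-- The dual function `g`. -/
noncomputable def dual (y : Vec m) : EReal :=
  ⨅ x ∈ P.X, P.obj x + ((inner ℝ y (P.res x) : ℝ) : EReal)

/-- The dual optimal value `g*`. -/
noncomputable def dualVal : EReal := ⨆ y, P.dual y

/-- The dual solution set `Y*`. -/
def dualSolutions : Set (Vec m) := {y | ∀ z, P.dual z ≤ P.dual y}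

/-- The standing assumption. In the last field, if `f` is finite on the whole space (or just on an
open set containing `X`), the two alternatives say that `X` is a polytope, respectively that some
`x` in the relative interior of `X` satisfies `A x = b`. -/
structure Standing : Prop where
  f₁_pcc : ProperClosedConvex P.f₁
  f₂_pcc : ProperClosedConvex P.f₂
  X₁_closed : IsClosed P.X₁
  X₂_closed : IsClosed P.X₂
  X₁_convex : Convex ℝ P.X₁
  X₂_convex : Convex ℝ P.X₂
  X_nonempty : P.X.Nonempty
  solvable : P.primalSolutions.Nonempty
  qualification :
    ((∃ S : Finset (Vec n₁ × Vec n₂), P.X = convexHull ℝ (S : Set (Vec n₁ × Vec n₂))) ∧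
      ∃ x ∈ P.feasible, x ∈ intrinsicInterior ℝ P.dom) ∨
    ∃ x ∈ intrinsicInterior ℝ (P.X ∩ P.dom), P.res x = 0

/-- `(1/2) sup {‖A₁ (x₁ - xc)‖² : x₁ ∈ X₁}`. -/
noncomputable def D₁ (xc : Vec n₁) : ℝ :=
  (1 / 2) * sSup ((fun x₁ => ‖P.A₁ (x₁ - xc)‖ ^ 2) '' P.X₁)

/-- `(1/2) sup {‖A x - b‖² : x ∈ X}`. -/
noncomputable def DA : ℝ := (1 / 2) * sSup ((fun x => ‖P.res x‖ ^ 2) '' P.X)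

/-- `max {D₁ + 3 DA, DY (DY + √(D₁ + 4 DA))}`, where `DY` is the least norm of a dual solution. -/
noncomputable def Dmax (xc : Vec n₁) (DY : ℝ) : ℝ :=
  max (P.D₁ xc + 3 * P.DA) (DY * (DY + √(P.D₁ xc + 4 * P.DA)))

/-- `x` is an `ε`-solution: `x ∈ X`, `|f x - f*| ≤ ε` and `‖A x - b‖ ≤ ε`. -/
def IsApproxSolution (ε : ℝ) (x : Vec n₁ × Vec n₂) : Prop :=
  x ∈ P.X ∧ (∃ v s : ℝ, P.obj x = v ∧ P.optVal = s ∧ |v - s| ≤ ε) ∧ ‖P.res x‖ ≤ ε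

/-- `(x, y)` is an `ε`-primal-dual solution: `x` is an `ε`-solution and `|g y - g*| ≤ ε`. -/
def IsApproxPrimalDual (ε : ℝ) (x : Vec n₁ × Vec n₂) (y : Vec m) : Prop :=
  P.IsApproxSolution ε x ∧ ∃ v s : ℝ, P.dual y = v ∧ P.dualVal = s ∧ |v - s| ≤ ε

end Problem

/-! The parameter schedule; `γ₀` is the free parameter. -/

noncomputable def tau (k : ℕ) : ℝ := 3 / (k + 4)

noncomputable def gam (γ₀ : ℝ) (k : ℕ) : ℝ := 2 * γ₀ / (k + 2)

noncomputable def bet (γ₀ : ℝ) (k : ℕ) : ℝ := 9 * (k + 3) / (γ₀ * (k + 1) * (k + 7))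

noncomputable def rho (γ₀ : ℝ) (k : ℕ) : ℝ := 3 * γ₀ / ((k + 3) * (k + 4))

noncomputable def eta (γ₀ : ℝ) (k : ℕ) : ℝ := γ₀ / (k + 3)

variable {n₁ n₂ m : ℕ}

/-- The two alternating minimizations and the dual ascent step at index `k`: from the multiplier
`yh` and the previous second block `z₂`, compute `x = (x₁, x₂)` and the new dual point `y`. -/
structure IsBlockStep (P : Problem n₁ n₂ m) (γ₀ : ℝ) (xc : Vec n₁) (k : ℕ) (yh : Vec m)
    (z₂ : Vec n₂) (x : Vec n₁ × Vec n₂) (y : Vec m) : Prop where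
  mem₁ : x.1 ∈ P.X₁
  min₁ : IsMinOn (fun x₁ => P.f₁ x₁ +
    (((gam γ₀ (k + 1) / 2) * ‖P.A₁ (x₁ - xc)‖ ^ 2 +
      (rho γ₀ k / 2) * ‖P.A₁ x₁ + P.A₂ z₂ - P.b + (rho γ₀ k)⁻¹ • yh‖ ^ 2 : ℝ) : EReal))
    P.X₁ x.1
  mem₂ : x.2 ∈ P.X₂
  min₂ : IsMinOn (fun x₂ => P.f₂ x₂ +
    (((eta γ₀ k / 2) * ‖P.A₁ x.1 + P.A₂ x₂ - P.b + (eta γ₀ k)⁻¹ • yh‖ ^ 2 : ℝ) : EReal))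
    P.X₂ x.2
  dual_eq : y = yh + eta γ₀ k • P.res x

/-- `(xb k, yb k)` is generated by the ADMM scheme with center `xc`; `x k` and `yh k` are the
auxiliary sequences. The starting point `(xb 0, yb 0)` comes from the block step at index `0` with
multiplier `0` and any second block in `X₂`; of `x 0` only the second block is used. -/
structure IsRun (P : Problem n₁ n₂ m) (γ₀ : ℝ) (xc : Vec n₁) (x xb : ℕ → Vec n₁ × Vec n₂)
    (yh yb : ℕ → Vec m) : Prop where
  center_mem : xc ∈ P.X₁
  init_mem : (x 0).2 ∈ P.X₂
  start : ∃ z₂ ∈ P.X₂, IsBlockStep P γ₀ xc 0 0 z₂ (xb 0) (yb 0)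
  yh_eq : ∀ k, yh k = (1 - tau k) • yb k + (tau k * (bet γ₀ k)⁻¹) • P.res (xb k)
  step : ∀ k, IsBlockStep P γ₀ xc k (yh k) (x k).2 (x (k + 1)) (yb (k + 1))
  xb_eq : ∀ k, xb (k + 1) = (1 - tau k) • xb k + tau k • x (k + 1)

end PADMM

/-! The scheme is controlled by one smoothed gap inequality: with F the objective and r(x) = A x -
b, for every u in X ∩ dom F, F(x̄ᵏ) + ‖r(x̄ᵏ)‖²/(2βₖ) ≤ F(u) + ⟨ȳᵏ, r(u)⟩ + (γₖ/2)‖A₁(u₁ - xc)‖² +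
3γₖ·DA. It is proved by induction. The optimality conditions of the two subproblems give a lower
bound for the smoothed Lagrangian at the new multiplier (`IsBlockStep.lagrangian_bound`). Adding (1
- τₖ) times the old gap at u = xᵏ⁺¹, the choice of ŷᵏ completes the square in the penalty, and the
parameter inequalities absorb the rest (`smoothedGapLE_step`).

Both γₖ and βₖ are O(1/k). At an optimal u the gap bounds F(x̄ᵏ) from above; a Kuhn-Tucker vector y*
bounds it from below by f* - ‖y*‖‖r(x̄ᵏ)‖. Together they give a quadratic inequality for ‖r(x̄ᵏ)‖,
hence both primal rates; minimizing the gap over u gives the dual rate.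

The existence of y* is strong duality under the qualification. A relative interior point allows the
M. Riesz extension theorem for equality constraints (`exists_multiplier_eq`). A polytope is written
in barycentric coordinates, as affine equalities and inequalities, and affine inequalities need no
Slater point (`exists_multiplier_ineq`). -/

namespace PADMM

/-! ### Lagrange multipliers for affine constraints -/

section Lagrange

/-- `z` lies in the algebraic relative interior of `D`: every segment from a point of `D` to `z`
can be prolonged inside `D`. -/
def IsRelCorePoint {E : Type*} [AddCommGroup E] [Module ℝ E] (D : Set E) (z : E) : Prop :=
  z ∈ D ∧ ∀ x ∈ D, ∃ ε : ℝ, 0 < ε ∧ z - ε • (x - z) ∈ D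

theorem affineMap_add_smul {E F : Type*} [AddCommGroup E] [Module ℝ E] [AddCommGroup F]
    [Module ℝ F] (h : E →ᵃ[ℝ] F) (x y : E) {a b : ℝ} (hab : a + b = 1) :
    h (a • x + b • y) = a • h x + b • h y :=
  Convex.combo_affine_apply hab

theorem affineMap_reflect {E F : Type*} [AddCommGroup E] [Module ℝ E] [AddCommGroup F]
    [Module ℝ F] (h : E →ᵃ[ℝ] F) (x z : E) (hz : h z = 0) (ε : ℝ) :
    h (z - ε • (x - z)) = -(ε • h x) := by
  have : z - ε • (x - z) = (1 + ε) • z + (-ε) • x := by module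
  rw [this, affineMap_add_smul h _ _ (by ring), hz]
  simp

/-- The cone generated by the image of the epigraph of `φ` under `(x, t) ↦ (h x, t)`. -/
def epigraphCone {E F : Type*} [AddCommGroup E] [Module ℝ E] [AddCommGroup F] [Module ℝ F]
    {D : Set E} {φ : E → ℝ} (hφ : ConvexOn ℝ D φ) (h : E →ᵃ[ℝ] F) (W : Submodule ℝ F) :
    ConvexCone ℝ (W × ℝ) where
  carrier := {p | ∃ c : ℝ, 0 ≤ c ∧ ∃ x ∈ D, (p.1 : F) = c • h x ∧ c * φ x ≤ p.2}
  smul_mem' := by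
    rintro c hc ⟨w, t⟩ ⟨d, hd, x, hx, h1, h2⟩
    refine ⟨c * d, mul_nonneg hc.le hd, x, hx, ?_, ?_⟩
    · simp only [Prod.smul_mk, Submodule.coe_smul]
      simp only at h1
      rw [h1, smul_smul]
    · simp only [Prod.smul_mk, smul_eq_mul]
      simp only at h2
      nlinarith
  add_mem' := by
    rintro ⟨w, t⟩ ⟨c, hc, x, hx, h1, h2⟩ ⟨w', t'⟩ ⟨c', hc', x', hx', h1', h2'⟩
    simp only at h1 h2 h1' h2'
    rcases (add_nonneg hc hc').eq_or_lt with hs | hs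
    · obtain rfl : c = 0 := by linarith
      obtain rfl : c' = 0 := by linarith
      refine ⟨0, le_rfl, x, hx, by simp [h1, h1'], ?_⟩
      simp only [Prod.mk_add_mk]
      linarith
    have hab : c / (c + c') + c' / (c + c') = 1 := by field_simp
    refine ⟨c + c', hs.le, (c / (c + c')) • x + (c' / (c + c')) • x',
      hφ.1 hx hx' (by positivity) (by positivity) hab, ?_, ?_⟩
    · simp only [Prod.mk_add_mk, Submodule.coe_add]
      rw [affineMap_add_smul h _ _ hab, h1, h1', smul_add, smul_smul, smul_smul]
      congr 2 <;> field_simp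
    · have := hφ.2 hx hx' (by positivity : 0 ≤ c / (c + c')) (by positivity : 0 ≤ c' / (c + c')) hab
      simp only [smul_eq_mul] at this
      have h3 := mul_le_mul_of_nonneg_left this hs.le
      have h4 : (c + c') * (c / (c + c') * φ x + c' / (c + c') * φ x') = c * φ x + c' * φ x' := by
        field_simp
      simp only [Prod.mk_add_mk]
      linarith

/-- Lagrange multipliers for affine equality constraints satisfied at a relative core point. -/
theorem exists_multiplier_eq {E F : Type*} [AddCommGroup E] [Module ℝ E] [AddCommGroup F]
    [Module ℝ F] {D : Set E} {φ : E → ℝ} (hφ : ConvexOn ℝ D φ) (h : E →ᵃ[ℝ] F) {z : E}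
    (hz : IsRelCorePoint D z) (hz0 : h z = 0) (hpos : ∀ x ∈ D, h x = 0 → 0 ≤ φ x) :
    ∃ l : F →ₗ[ℝ] ℝ, ∀ x ∈ D, 0 ≤ φ x + l (h x) := by
  set W : Submodule ℝ F := Submodule.span ℝ (h '' D) with hW
  -- The relative core condition makes the cone over h(D) a whole subspace, which is what the Riesz
  -- extension requires.
  have hcone : ∀ w ∈ W, ∃ c : ℝ, 0 < c ∧ ∃ x ∈ D, w = c • h x := by
    intro w hw
    induction hw using Submodule.span_induction with
    | mem w hw =>
      obtain ⟨x, hx, rfl⟩ := hw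
      exact ⟨1, one_pos, x, hx, by simp⟩
    | zero => exact ⟨1, one_pos, z, hz.1, by simp [hz0]⟩
    | add v w _ _ hv hw =>
      obtain ⟨c, hc, x, hx, rfl⟩ := hv
      obtain ⟨c', hc', x', hx', rfl⟩ := hw
      have hs : 0 < c + c' := add_pos hc hc'
      have hab : c / (c + c') + c' / (c + c') = 1 := by field_simp
      refine ⟨c + c', hs, (c / (c + c')) • x + (c' / (c + c')) • x',
        hφ.1 hx hx' (by positivity) (by positivity) hab, ?_⟩
      rw [affineMap_add_smul h _ _ hab, smul_add, smul_smul, smul_smul]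
      congr 2 <;> field_simp
    | smul a w _ hw =>
      obtain ⟨c, hc, x, hx, rfl⟩ := hw
      rcases lt_trichotomy a 0 with ha | ha | ha
      -- Negative multiples come from prolonging the segment from x beyond z, where h changes sign.
      · obtain ⟨ε, hε, hx'⟩ := hz.2 x hx
        refine ⟨-a * c / ε, by have : 0 < -a := by linarith
                               positivity, _, hx', ?_⟩
        rw [affineMap_reflect h x z hz0, ← smul_neg, smul_smul, smul_smul, ← neg_one_smul ℝ (h x),
          smul_smul]
        congr 1
        field_simp
      · exact ⟨1, one_pos, z, hz.1, by simp [hz0, ha]⟩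
      · exact ⟨a * c, mul_pos ha hc, x, hx, by rw [smul_smul]⟩
  -- The functional (0, t) ↦ t, nonnegative on the epigraph cone by `hpos`. For its extension g, the
  -- map w ↦ g (w, 0) is the multiplier on W.
  let f : (W × ℝ) →ₗ.[ℝ] ℝ :=
    { domain := Submodule.prod ⊥ ⊤
      toFun := (LinearMap.snd ℝ W ℝ).domRestrict _ }
  have hpt : (epigraphCone hφ h W).Pointed := ⟨0, le_rfl, z, hz.1, by simp, by simp⟩
  obtain ⟨g, hgf, hg⟩ := riesz_extension ((epigraphCone hφ h W).toPointedCone hpt) f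
    (by
      rintro ⟨⟨w, t⟩, hwt⟩ ⟨c, hc, x, hx, h1, h2⟩
      have hw : w = 0 := by simpa [f] using hwt
      subst hw
      simp only [Submodule.coe_zero] at h1
      refine le_trans ?_ h2
      rcases smul_eq_zero.1 h1.symm with hc0 | hx0
      · simp [hc0]
      · exact mul_nonneg hc (hpos x hx hx0))
    (by
      rintro ⟨w, t⟩
      obtain ⟨c, hc, x, hx, h1⟩ := hcone w w.2
      refine ⟨⟨(0, c * φ x - t), by simp [f]⟩, c, hc.le, x, hx, ?_, ?_⟩
      · simpa using h1
      · simp)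
  obtain ⟨l, hl⟩ := LinearMap.exists_extend (g.comp (LinearMap.inl ℝ W ℝ))
  refine ⟨l, fun x hx => ?_⟩
  have hxW : h x ∈ W := Submodule.subset_span ⟨x, hx, rfl⟩
  have h1 : 0 ≤ g (⟨h x, hxW⟩, φ x) := hg _ ⟨1, zero_le_one, x, hx, by simp, by simp⟩
  have h2 : g (0, φ x) = φ x := hgf ⟨(0, φ x), by simp [f]⟩
  have h3 : l (h x) = g (⟨h x, hxW⟩, 0) := by
    have := LinearMap.congr_fun hl ⟨h x, hxW⟩
    simpa using this
  have h4 : ((⟨h x, hxW⟩, φ x) : W × ℝ) = (⟨h x, hxW⟩, 0) + (0, φ x) := by simp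
  rw [h4, map_add, h2, ← h3] at h1
  linarith

/-- A Lagrange multiplier for one affine inequality constraint with a Slater point. -/
theorem exists_multiplier_slater {E : Type*} [AddCommGroup E] [Module ℝ E] {Q : Set E}
    {φ : E → ℝ} (hφ : ConvexOn ℝ Q φ) (a : E →ᵃ[ℝ] ℝ) {z : E} (hzQ : z ∈ Q) (hz : 0 < a z)
    (hpos : ∀ x ∈ Q, 0 ≤ a x → 0 ≤ φ x) :
    ∃ μ : ℝ, 0 ≤ μ ∧ ∀ x ∈ Q, 0 ≤ φ x - μ * a x := by
  -- A valid μ lies above φ / a where a < 0 and below it where a > 0. Inserting 0 forces μ ≥ 0 and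
  -- keeps the set nonempty.
  set S : Set ℝ := insert 0 ((fun x => φ x / a x) '' {x ∈ Q | a x < 0}) with hS
  have key : ∀ y ∈ Q, 0 < a y → ∀ s ∈ S, s ≤ φ y / a y := by
    intro y hy hay s hs
    rcases hs with rfl | ⟨x, ⟨hx, hax⟩, rfl⟩
    · exact div_nonneg (hpos y hy hay.le) hay.le
    · have hd : 0 < a y - a x := by linarith
      have hab : a y / (a y - a x) + (-a x) / (a y - a x) = 1 := by
        rw [← add_div, ← sub_eq_add_neg, div_self hd.ne']
      have h1 : 0 ≤ a y / (a y - a x) := by positivity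
      have h2 : 0 ≤ (-a x) / (a y - a x) := div_nonneg (by linarith) hd.le
      -- The weights are those of the zero of a on the segment from x to y.
      have h3 := hpos _ (hφ.1 hx hy h1 h2 hab) (by
        rw [affineMap_add_smul a _ _ hab]
        simp only [smul_eq_mul]
        apply le_of_eq
        field_simp
        ring)
      have h4 := h3.trans (hφ.2 hx hy h1 h2 hab)
      simp only [smul_eq_mul] at h4
      have h5 : 0 ≤ a y * φ x - a x * φ y := by
        have := mul_nonneg hd.le h4
        have e : (a y - a x) * (a y / (a y - a x) * φ x + -a x / (a y - a x) * φ y)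
          = a y * φ x - a x * φ y := by field_simp; ring
        linarith
      show φ x / a x ≤ φ y / a y
      rw [← neg_div_neg_eq (φ x), div_le_div_iff₀ (by linarith) hay]
      linarith
  have hbdd : BddAbove S := ⟨_, key z hzQ hz⟩
  have hμ : 0 ≤ sSup S := le_csSup hbdd (Set.mem_insert _ _)
  refine ⟨sSup S, hμ, fun x hx => ?_⟩
  rcases lt_trichotomy (a x) 0 with hax | hax | hax
  · have : φ x / a x ≤ sSup S := le_csSup hbdd (Set.mem_insert_of_mem _ ⟨x, ⟨hx, hax⟩, rfl⟩)
    rw [div_le_iff_of_neg hax] at this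
    linarith
  · rw [hax]
    simpa using hpos x hx hax.ge
  · have : sSup S ≤ φ x / a x := csSup_le (Set.insert_nonempty _ _) (key x hx hax)
    rw [le_div_iff₀ hax] at this
    linarith

theorem convexOn_add_mul_affine {E : Type*} [AddCommGroup E] [Module ℝ E] {Q : Set E}
    {φ : E → ℝ} (hφ : ConvexOn ℝ Q φ) (a : E →ᵃ[ℝ] ℝ) (c : ℝ) :
    ConvexOn ℝ Q (fun x => φ x + c * a x) := by
  refine ⟨hφ.1, fun x hx y hy s t hs ht hst => ?_⟩
  have := hφ.2 hx hy hs ht hst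
  simp only [affineMap_add_smul a _ _ hst, smul_eq_mul] at this ⊢
  linarith

/-- Lagrange multipliers for affine equality and inequality constraints satisfied at a relative
core point: no Slater condition is needed for the affine inequalities. -/
theorem exists_multiplier_ineq {E : Type*} [AddCommGroup E] [Module ℝ E] {D : Set E} {z : E}
    (hz : IsRelCorePoint D z) {ι : Type*} [DecidableEq ι] (a : ι → E →ᵃ[ℝ] ℝ) (I : Finset ι)
    (haz : ∀ i ∈ I, 0 ≤ a i z) :
    ∀ {F : Type} [AddCommGroup F] [Module ℝ F] {φ : E → ℝ} (_ : ConvexOn ℝ D φ)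
      (h : E →ᵃ[ℝ] F) (_ : h z = 0)
      (_ : ∀ x ∈ D, h x = 0 → (∀ i ∈ I, 0 ≤ a i x) → 0 ≤ φ x),
      ∃ l : F →ₗ[ℝ] ℝ, ∃ μ : ι → ℝ, (∀ i ∈ I, 0 ≤ μ i) ∧
        ∀ x ∈ D, 0 ≤ φ x + l (h x) - ∑ i ∈ I, μ i * a i x := by
  -- The inductive step changes φ by a multiple of `a j`, or enlarges F to F × ℝ, so both stay
  -- universally quantified.
  induction I using Finset.induction_on with
  | empty =>
    intro F _ _ φ hφ h hz0 hpos
    obtain ⟨l, hl⟩ := exists_multiplier_eq hφ h hz hz0 (fun x hx hx0 => hpos x hx hx0 (by simp))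
    exact ⟨l, 0, by simp, by simpa using hl⟩
  | insert j I hj ih =>
    intro F _ _ φ hφ h hz0 hpos
    have hazI : ∀ i ∈ I, 0 ≤ a i z := fun i hi => haz i (Finset.mem_insert_of_mem hi)
    have sum_upd : ∀ (μ : ι → ℝ) (c : ℝ) (x : E),
        ∑ i ∈ insert j I, Function.update μ j c i * a i x = c * a j x + ∑ i ∈ I, μ i * a i x := by
      intro μ c x
      rw [Finset.sum_insert hj, Function.update_self]
      congr 1
      refine Finset.sum_congr rfl fun i hi => ?_
      rw [Function.update_of_ne (ne_of_mem_of_not_mem hi hj)]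
    have upd_nonneg : ∀ (μ : ι → ℝ) (c : ℝ), 0 ≤ c → (∀ i ∈ I, 0 ≤ μ i) →
        ∀ i ∈ insert j I, 0 ≤ Function.update μ j c i := by
      intro μ c hc hμ i hi
      rcases Finset.mem_insert.1 hi with rfl | hi
      · simpa
      · rw [Function.update_of_ne (ne_of_mem_of_not_mem hi hj)]
        exact hμ i hi
    by_cases hsl : ∃ y ∈ D, h y = 0 ∧ (∀ i ∈ I, 0 ≤ a i y) ∧ 0 < a j y
    · obtain ⟨y, hyD, hy0, hyI, hyj⟩ := hsl
      set Q : Set E := {x ∈ D | h x = 0 ∧ ∀ i ∈ I, 0 ≤ a i x} with hQ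
      have hQc : Convex ℝ Q := by
        rintro x ⟨hx, hx0, hxI⟩ y ⟨hy, hy0, hyI⟩ s t hs ht hst
        refine ⟨hφ.1 hx hy hs ht hst, ?_, fun i hi => ?_⟩
        · rw [affineMap_add_smul h _ _ hst, hx0, hy0]; simp
        · rw [affineMap_add_smul (a i) _ _ hst]
          have h1 := hxI i hi
          have h2 := hyI i hi
          simp only [smul_eq_mul]
          positivity
      obtain ⟨μ, hμ0, hμ⟩ := exists_multiplier_slater (hφ.subset (fun x hx => hx.1) hQc) (a j)
        (z := y) ⟨hyD, hy0, hyI⟩ hyj (fun x hx hxj => hpos x hx.1 hx.2.1 (by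
          intro i hi
          rcases Finset.mem_insert.1 hi with rfl | hi
          · exact hxj
          · exact hx.2.2 i hi))
      obtain ⟨l, ν, hν, hl⟩ := ih hazI (convexOn_add_mul_affine hφ (a j) (-μ)) h hz0
        (fun x hx hx0 hxI => by have := hμ x ⟨hx, hx0, hxI⟩; linarith)
      refine ⟨l, Function.update ν j μ, upd_nonneg ν μ hμ0 hν, fun x hx => ?_⟩
      rw [sum_upd]
      have := hl x hx
      linarith
    -- Here `a j` ≤ 0 on the set cut out by the other constraints, so it may be imposed as an
    -- equality, with a multiplier ν of either sign. If ν ≤ 0, -ν is admissible. If ν ≥ 0, the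
    -- multipliers certifying -`a j` ≥ 0, scaled by ν, cancel the term ν * `a j`.
    · push Not at hsl
      have hzj : a j z = 0 :=
        le_antisymm (hsl z hz.1 hz0 hazI) (haz j (Finset.mem_insert_self _ _))
      obtain ⟨l, μ, hμ, hl⟩ := ih hazI hφ (h.prod (a j)) (by simp [hz0, hzj]) (by
        intro x hx hx0 hxI
        rw [AffineMap.prod_apply, Prod.mk_eq_zero] at hx0
        refine hpos x hx hx0.1 fun i hi => ?_
        rcases Finset.mem_insert.1 hi with rfl | hi
        · exact hx0.2.ge
        · exact hxI i hi)
      obtain ⟨l', μ', hμ', hl'⟩ := ih hazI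
        (convexOn_add_mul_affine (convexOn_const 0 hφ.1) (a j) (-1)) h hz0
        (fun x hx hx0 hxI => by have := hsl x hx hx0 hxI; linarith)
      set ν : ℝ := l (0, 1) with hνdef
      have hsplit : ∀ x, l ((h.prod (a j)) x) = l.comp (LinearMap.inl ℝ F ℝ) (h x) + ν * a j x := by
        intro x
        have : (h.prod (a j)) x = (h x, 0) + a j x • ((0, 1) : F × ℝ) := by simp
        rw [this, map_add, map_smul, smul_eq_mul, mul_comm]
        rfl
      rcases le_total ν 0 with hν | hν
      · refine ⟨l.comp (LinearMap.inl ℝ F ℝ), Function.update μ j (-ν),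
          upd_nonneg μ (-ν) (by linarith) hμ, fun x hx => ?_⟩
        rw [sum_upd]
        have := hl x hx
        rw [hsplit] at this
        linarith
      · refine ⟨l.comp (LinearMap.inl ℝ F ℝ) + ν • l', Function.update (μ + ν • μ') j 0,
          upd_nonneg _ 0 le_rfl (fun i hi => ?_), fun x hx => ?_⟩
        · exact add_nonneg (hμ i hi) (mul_nonneg hν (hμ' i hi))
        · rw [sum_upd]
          have h1 := hl x hx
          have h2 := mul_nonneg hν (hl' x hx)
          rw [hsplit] at h1
          have e : ∑ i ∈ I, (μ + ν • μ') i * a i x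
              = ∑ i ∈ I, μ i * a i x + ν * ∑ i ∈ I, μ' i * a i x := by
            rw [Finset.mul_sum, ← Finset.sum_add_distrib]
            refine Finset.sum_congr rfl fun i _ => ?_
            simp only [Pi.add_apply, Pi.smul_apply, smul_eq_mul]
            ring
          rw [e]
          simp only [LinearMap.add_apply, LinearMap.smul_apply, smul_eq_mul]
          linarith

/-- The line through x and z stays in the affine span of D, and D is a neighbourhood of z there. -/
theorem isRelCorePoint_of_mem_intrinsicInterior {E : Type*} [NormedAddCommGroup E]
    [NormedSpace ℝ E] {D : Set E} {z : E} (hz : z ∈ intrinsicInterior ℝ D) :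
    IsRelCorePoint D z := by
  have hzD : z ∈ D := intrinsicInterior_subset hz
  refine ⟨hzD, fun x hx => ?_⟩
  obtain ⟨w, hw, rfl⟩ := mem_intrinsicInterior.1 hz
  have hxs : x ∈ affineSpan ℝ D := subset_affineSpan ℝ D hx
  let p : ℝ → affineSpan ℝ D := fun t =>
    ⟨AffineMap.lineMap (w : E) x (-t), AffineMap.lineMap_mem _ w.2 hxs⟩
  have hp : Continuous p := by
    refine Continuous.subtype_mk ?_ _
    exact AffineMap.lineMap_continuous.comp continuous_neg
  have hp0 : p 0 = w := by
    apply Subtype.ext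
    simp [p]
  have hnhds : p ⁻¹' ((↑) ⁻¹' D) ∈ nhds (0 : ℝ) :=
    hp.continuousAt.preimage_mem_nhds (by rw [hp0]; exact mem_interior_iff_mem_nhds.1 hw)
  obtain ⟨ε, hε, hball⟩ := Metric.mem_nhds_iff.1 hnhds
  refine ⟨ε / 2, by positivity, ?_⟩
  have h1 : (p (ε / 2) : E) ∈ D := hball (by
    rw [Metric.mem_ball, Real.dist_eq, sub_zero, abs_of_pos (by positivity)]
    linarith)
  have h2 : (p (ε / 2) : E) = (w : E) - (ε / 2) • (x - w) := by
    simp only [p, AffineMap.lineMap_apply, vsub_eq_sub, vadd_eq_add]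
    module
  rwa [h2] at h1

end Lagrange

end PADMM

/-! ### Polytope constraints and strong duality -/

namespace PADMM

/-- Lagrange multipliers for affine equality constraints over the intersection of a polytope with
a convex set `D`, when the polytope contains a feasible relative core point of `D`. -/
theorem exists_multiplier_polytope {E : Type*} {F : Type} [AddCommGroup E] [Module ℝ E]
    [AddCommGroup F] [Module ℝ F] (S : Finset E) {D : Set E} {φ : E → ℝ} (hφ : ConvexOn ℝ D φ)
    (h : E →ᵃ[ℝ] F) {z : E} (hz : IsRelCorePoint D z) (hzS : z ∈ convexHull ℝ (S : Set E))
    (hz0 : h z = 0)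
    (hpos : ∀ x ∈ D, x ∈ convexHull ℝ (S : Set E) → h x = 0 → 0 ≤ φ x) :
    ∃ l : F →ₗ[ℝ] ℝ, ∀ x ∈ D, x ∈ convexHull ℝ (S : Set E) → 0 ≤ φ x + l (h x) := by
  classical
  -- Barycentric coordinates: the hull is the image under L of {w ≥ 0, σ w = 1}. Any weights of z
  -- are a relative core point of L⁻¹(D), even when some of them vanish.
  let L : (S → ℝ) →ₗ[ℝ] E := Fintype.linearCombination ℝ (fun s : S => (s : E))
  have hL : ∀ w, L w = ∑ s : S, w s • (s : E) := fun w =>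
    Fintype.linearCombination_apply ℝ _ w
  let σ : (S → ℝ) →ₗ[ℝ] ℝ := ∑ s : S, LinearMap.proj s
  have hσ : ∀ w, σ w = ∑ s : S, w s := fun w => by simp [σ]
  let a : S → (S → ℝ) →ᵃ[ℝ] ℝ := fun s => (LinearMap.proj s : (S → ℝ) →ₗ[ℝ] ℝ).toAffineMap
  let H : (S → ℝ) →ᵃ[ℝ] F × ℝ :=
    (h.comp L.toAffineMap).prod (σ.toAffineMap - AffineMap.const ℝ _ 1)
  have hH : ∀ w, H w = (h (L w), σ w - 1) := fun w => by simp [H]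
  have ha : ∀ s w, a s w = w s := fun s w => rfl
  have hull : ∀ x, x ∈ convexHull ℝ (S : Set E) ↔
      ∃ w : S → ℝ, (∀ s, 0 ≤ w s) ∧ σ w = 1 ∧ L w = x := by
    intro x
    rw [Finset.mem_convexHull']
    constructor
    · rintro ⟨w, h0, h1, h2⟩
      refine ⟨fun s => w s, fun s => h0 s s.2, ?_, ?_⟩
      · rw [hσ, ← h1]; exact Finset.sum_coe_sort S w
      · rw [hL, ← h2]; exact Finset.sum_coe_sort S (fun y => w y • y)
    · rintro ⟨w, h0, h1, h2⟩
      refine ⟨fun y => if hy : y ∈ S then w ⟨y, hy⟩ else 0, fun y hy => ?_, ?_, ?_⟩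
      · simp [hy, h0]
      · rw [← h1, hσ, ← Finset.sum_coe_sort S]
        exact Finset.sum_congr rfl fun s _ => by simp
      · rw [← h2, hL, ← Finset.sum_coe_sort S]
        exact Finset.sum_congr rfl fun s _ => by simp
  obtain ⟨w₀, hw0, hw1, hw2⟩ := (hull z).1 hzS
  have hcore : IsRelCorePoint (L ⁻¹' D) w₀ := by
    refine ⟨by rw [Set.mem_preimage, hw2]; exact hz.1, fun w hw => ?_⟩
    obtain ⟨ε, hε, h1⟩ := hz.2 (L w) hw
    refine ⟨ε, hε, ?_⟩
    rwa [Set.mem_preimage, map_sub, map_smul, map_sub, hw2]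
  obtain ⟨l, μ, hμ, hl⟩ := exists_multiplier_ineq hcore a Finset.univ (fun s _ => hw0 s)
    (hφ.comp_linearMap L) H (by rw [hH, hw2, hw1, hz0]; simp) (by
      intro w hw hw0 hwa
      rw [hH, Prod.mk_eq_zero] at hw0
      exact hpos (L w) hw ((hull _).2 ⟨w, fun s => hwa s (Finset.mem_univ _),
        by linarith [hw0.2], rfl⟩) hw0.1)
  refine ⟨l.comp (LinearMap.inl ℝ F ℝ), fun x hx hxS => ?_⟩
  obtain ⟨w, hw0, hw1, rfl⟩ := (hull x).1 hxS
  have h1 := hl w hx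
  have h2 : 0 ≤ ∑ s, μ s * a s w :=
    Finset.sum_nonneg fun s hs => mul_nonneg (hμ s hs) (hw0 s)
  rw [hH, hw1, sub_self] at h1
  simp only [Function.comp_apply] at h1
  simp only [LinearMap.comp_apply, LinearMap.inl_apply]
  linarith

theorem ProperClosedConvex.coe_toReal {n : ℕ} {f : Vec n → EReal} (hf : ProperClosedConvex f)
    {x : Vec n} (hx : f x ≠ ⊤) : ((f x).toReal : EReal) = f x :=
  EReal.coe_toReal hx (hf.ne_bot x)

theorem ProperClosedConvex.convexOn_toReal {n : ℕ} {f : Vec n → EReal}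
    (hf : ProperClosedConvex f) : ConvexOn ℝ {x | f x ≠ ⊤} (fun x => (f x).toReal) := by
  have key : ∀ x, f x ≠ ⊤ → ∀ y, f y ≠ ⊤ → ∀ a b : ℝ, 0 ≤ a → 0 ≤ b → a + b = 1 →
      f (a • x + b • y) ≤ ((a * (f x).toReal + b * (f y).toReal : ℝ) : EReal) := by
    intro x hx y hy a b ha hb hab
    have hx' : (x, (f x).toReal) ∈ {p : Vec n × ℝ | f p.1 ≤ (p.2 : EReal)} :=
      (hf.coe_toReal hx).ge
    have hy' : (y, (f y).toReal) ∈ {p : Vec n × ℝ | f p.1 ≤ (p.2 : EReal)} :=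
      (hf.coe_toReal hy).ge
    exact hf.convex hx' hy' ha hb hab
  refine ⟨fun x hx y hy a b ha hb hab => ?_, fun x hx y hy a b ha hb hab => ?_⟩
  · exact ne_top_of_le_ne_top (EReal.coe_ne_top _) (key x hx y hy a b ha hb hab)
  · have h1 := key x hx y hy a b ha hb hab
    have h2 := ne_top_of_le_ne_top (EReal.coe_ne_top _) h1
    rw [← hf.coe_toReal h2, EReal.coe_le_coe_iff] at h1
    simpa only [smul_eq_mul] using h1

namespace Problem

variable {n₁ n₂ m : ℕ} (P : Problem n₁ n₂ m)

/-- The objective as a real-valued function, meaningful on `P.dom`. -/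
noncomputable def realObj (x : Vec n₁ × Vec n₂) : ℝ := (P.f₁ x.1).toReal + (P.f₂ x.2).toReal

/-- The residual as an affine map. -/
noncomputable def resAffine : Vec n₁ × Vec n₂ →ᵃ[ℝ] Vec m :=
  (P.A₁.coprod P.A₂).toLinearMap.toAffineMap - AffineMap.const ℝ _ P.b

theorem resAffine_apply (x : Vec n₁ × Vec n₂) : P.resAffine x = P.res x := by
  simp [resAffine, res]

variable {P}

theorem Standing.obj_eq (hP : P.Standing) {x : Vec n₁ × Vec n₂} (hx : x ∈ P.dom) :
    P.obj x = (P.realObj x : EReal) := by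
  rw [obj, realObj, EReal.coe_add, hP.f₁_pcc.coe_toReal hx.1, hP.f₂_pcc.coe_toReal hx.2]

theorem Standing.obj_eq_top (hP : P.Standing) {x : Vec n₁ × Vec n₂} (hx : x ∉ P.dom) :
    P.obj x = ⊤ := by
  rw [obj]
  by_cases h1 : P.f₁ x.1 = ⊤
  · rw [h1, EReal.top_add_of_ne_bot (hP.f₂_pcc.ne_bot _)]
  · have h2 : P.f₂ x.2 = ⊤ := by
      by_contra h2
      exact hx ⟨h1, h2⟩
    rw [h2, EReal.add_top_of_ne_bot (hP.f₁_pcc.ne_bot _)]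

theorem Standing.convexOn_realObj (hP : P.Standing) : ConvexOn ℝ P.dom P.realObj := by
  have h1 := hP.f₁_pcc.convexOn_toReal
  have h2 := hP.f₂_pcc.convexOn_toReal
  refine ⟨fun x hx y hy a b ha hb hab => ⟨h1.1 hx.1 hy.1 ha hb hab, h2.1 hx.2 hy.2 ha hb hab⟩,
    fun x hx y hy a b ha hb hab => ?_⟩
  have e1 := h1.2 hx.1 hy.1 ha hb hab
  have e2 := h2.2 hx.2 hy.2 ha hb hab
  simp only [realObj, smul_eq_mul, Prod.fst_add, Prod.snd_add, Prod.smul_fst, Prod.smul_snd]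
    at e1 e2 ⊢
  linarith

theorem Standing.convex_X (hP : P.Standing) : Convex ℝ P.X := hP.X₁_convex.prod hP.X₂_convex

/-- The optimal value is attained, and a Kuhn-Tucker vector exists. -/
theorem Standing.exists_kuhnTucker (hP : P.Standing) :
    ∃ z ∈ P.feasible, z ∈ P.dom ∧ P.optVal = (P.realObj z : EReal) ∧
      ∃ y : Vec m, ∀ x ∈ P.X ∩ P.dom, P.realObj z ≤ P.realObj x + inner ℝ y (P.res x) := by
  obtain ⟨z, hz, hzt, hzmin⟩ := hP.solvable
  have hzd : z ∈ P.dom := by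
    by_contra h
    exact hzt (hP.obj_eq_top h)
  refine ⟨z, hz, hzd, ?_, ?_⟩
  · rw [← hP.obj_eq hzd]
    exact le_antisymm (iInf₂_le z hz) (le_iInf₂ hzmin)
  have hpos : ∀ x ∈ P.dom, x ∈ P.X → P.resAffine x = 0 → 0 ≤ P.realObj x + -P.realObj z := by
    intro x hxd hxX hx0
    rw [P.resAffine_apply] at hx0
    have := hzmin x ⟨hxX, hx0⟩
    rw [hP.obj_eq hzd, hP.obj_eq hxd, EReal.coe_le_coe_iff] at this
    linarith
  have hconv : ConvexOn ℝ P.dom (fun x => P.realObj x + -P.realObj z) :=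
    hP.convexOn_realObj.add_const _
  obtain ⟨l, hl⟩ : ∃ l : Vec m →ₗ[ℝ] ℝ, ∀ x ∈ P.dom, x ∈ P.X →
      0 ≤ (P.realObj x + -P.realObj z) + l (P.resAffine x) := by
    rcases hP.qualification with ⟨⟨S, hS⟩, x₀, hx₀, hx₀d⟩ | ⟨x₀, hx₀, hx₀r⟩
    · rw [hS] at hpos ⊢
      exact exists_multiplier_polytope S hconv P.resAffine
        (isRelCorePoint_of_mem_intrinsicInterior hx₀d) (hS ▸ hx₀.1)
        (by rw [P.resAffine_apply]; exact hx₀.2) hpos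
    · obtain ⟨l, hl⟩ := exists_multiplier_eq
        (hconv.subset Set.inter_subset_right (hP.convex_X.inter hP.convexOn_realObj.1))
        P.resAffine (isRelCorePoint_of_mem_intrinsicInterior hx₀)
        (by rw [P.resAffine_apply]; exact hx₀r) (fun x hx => hpos x hx.2 hx.1)
      exact ⟨l, fun x hxd hxX => hl x ⟨hxX, hxd⟩⟩
  refine ⟨(InnerProductSpace.toDual ℝ (Vec m)).symm (LinearMap.toContinuousLinearMap l),
    fun x hx => ?_⟩
  rw [InnerProductSpace.toDual_symm_apply]
  have := hl x hx.2 hx.1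
  rw [P.resAffine_apply] at this
  simp only [LinearMap.coe_toContinuousLinearMap']
  linarith

/-- Off the domain the objective is `⊤`, so only X ∩ dom matters and the comparison becomes one of
real numbers. -/
theorem Standing.le_dual_iff (hP : P.Standing) {y : Vec m} {c : ℝ} :
    (c : EReal) ≤ P.dual y ↔ ∀ x ∈ P.X ∩ P.dom, c ≤ P.realObj x + inner ℝ y (P.res x) := by
  rw [dual, le_iInf₂_iff]
  constructor
  · intro h x hx
    have := h x hx.1
    rwa [hP.obj_eq hx.2, ← EReal.coe_add, EReal.coe_le_coe_iff] at this
  · intro h x hx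
    by_cases hxd : x ∈ P.dom
    · rw [hP.obj_eq hxd, ← EReal.coe_add, EReal.coe_le_coe_iff]
      exact h x ⟨hx, hxd⟩
    · rw [hP.obj_eq_top hxd, EReal.top_add_of_ne_bot (EReal.coe_ne_bot _)]
      exact le_top

theorem Standing.dual_le (hP : P.Standing) {z : Vec n₁ × Vec n₂} (hz : z ∈ P.feasible)
    (hzd : z ∈ P.dom) (y : Vec m) : P.dual y ≤ (P.realObj z : EReal) := by
  refine (iInf₂_le z hz.1).trans ?_
  rw [hP.obj_eq hzd, hz.2, inner_zero_right, EReal.coe_zero, add_zero]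

/-- Strong duality: the dual value equals the optimal value, the dual solutions are the
Kuhn-Tucker vectors, and there is a dual solution of least norm. -/
theorem Standing.exists_isLeast_dualSolutions (hP : P.Standing) :
    ∃ z ∈ P.feasible, z ∈ P.dom ∧ P.optVal = (P.realObj z : EReal) ∧
      P.dualVal = (P.realObj z : EReal) ∧
      ∃ y : Vec m, IsLeast ((fun y => ‖y‖) '' P.dualSolutions) ‖y‖ ∧
        ∀ x ∈ P.X ∩ P.dom, P.realObj z ≤ P.realObj x + inner ℝ y (P.res x) := by
  obtain ⟨z, hz, hzd, hopt, y₀, hy₀⟩ := hP.exists_kuhnTucker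
  have hle := hP.dual_le hz hzd
  have hy₀' := hP.le_dual_iff.2 hy₀
  have hmem : ∀ y, y ∈ P.dualSolutions ↔
      ∀ x ∈ P.X ∩ P.dom, P.realObj z ≤ P.realObj x + inner ℝ y (P.res x) := by
    intro y
    rw [← hP.le_dual_iff]
    exact ⟨fun h => hy₀'.trans (h y₀), fun h w => (hle w).trans h⟩
  refine ⟨z, hz, hzd, hopt, le_antisymm (iSup_le hle) (hy₀'.trans (le_iSup _ y₀)), ?_⟩
  -- The Kuhn-Tucker vectors form an intersection of closed half-spaces, so a nearest one to 0
  -- exists.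
  have hclosed : IsClosed P.dualSolutions := by
    have : P.dualSolutions = ⋂ x ∈ P.X ∩ P.dom,
        {y | P.realObj z ≤ P.realObj x + inner ℝ y (P.res x)} := by
      ext y
      rw [hmem, Set.mem_iInter₂]
      rfl
    rw [this]
    refine isClosed_biInter fun x _ => isClosed_le continuous_const ?_
    fun_prop
  obtain ⟨y, hy, hmin⟩ := hclosed.exists_infDist_eq_dist ⟨y₀, (hmem y₀).2 hy₀⟩ 0
  refine ⟨y, ⟨⟨y, hy, rfl⟩, ?_⟩, (hmem y).1 hy⟩
  rintro _ ⟨w, hw, rfl⟩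
  have := Metric.infDist_le_dist_of_mem (x := (0 : Vec m)) hw
  rwa [hmin, dist_zero_left, dist_zero_left] at this

end Problem

end PADMM

/-! ### The parameter schedule -/

namespace PADMM

section Parameters

theorem one_sub_tau (k : ℕ) : 1 - tau k = (k + 1) / (k + 4) := by
  rw [tau]; field_simp; ring

theorem tau_pos (k : ℕ) : 0 < tau k := by rw [tau]; positivity

theorem one_sub_tau_pos (k : ℕ) : 0 < 1 - tau k := by rw [one_sub_tau]; positivity

theorem gam_pos {γ₀ : ℝ} (h : 0 < γ₀) (k : ℕ) : 0 < gam γ₀ k := by rw [gam]; positivity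

theorem bet_pos {γ₀ : ℝ} (h : 0 < γ₀) (k : ℕ) : 0 < bet γ₀ k := by rw [bet]; positivity

theorem rho_pos {γ₀ : ℝ} (h : 0 < γ₀) (k : ℕ) : 0 < rho γ₀ k := by rw [rho]; positivity

theorem eta_pos {γ₀ : ℝ} (h : 0 < γ₀) (k : ℕ) : 0 < eta γ₀ k := by rw [eta]; positivity

theorem gam_succ (γ₀ : ℝ) (k : ℕ) : gam γ₀ (k + 1) = 2 * γ₀ / (k + 3) := by
  rw [gam]; push_cast; ring_nf

/-- Lets the new proximal term at x₁ᵏ⁺¹ absorb the one inherited from the old gap. -/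
theorem one_sub_tau_mul_gam_le {γ₀ : ℝ} (h : 0 < γ₀) (k : ℕ) :
    (1 - tau k) * gam γ₀ k ≤ gam γ₀ (k + 1) := by
  have hk : (0 : ℝ) ≤ k := k.cast_nonneg
  rw [one_sub_tau, gam_succ, gam, div_mul_div_comm, div_le_div_iff₀ (by positivity) (by positivity)]
  have : (0 : ℝ) ≤ γ₀ * (2 * k + 5) := by positivity
  nlinarith

theorem one_sub_tau_mul_bet {γ₀ : ℝ} (h : 0 < γ₀) (k : ℕ) :
    (1 - tau k) * bet γ₀ k = 9 * (k + 3) / (γ₀ * (k + 4) * (k + 7)) := by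
  rw [one_sub_tau, bet]
  field_simp

/-- Lets the penalty weight 1/(2βₖ₊₁) be replaced by the weight that completes the square. -/
theorem one_sub_tau_mul_bet_le {γ₀ : ℝ} (h : 0 < γ₀) (k : ℕ) :
    (1 - tau k) * bet γ₀ k ≤ bet γ₀ (k + 1) := by
  have hk : (0 : ℝ) ≤ k := k.cast_nonneg
  rw [one_sub_tau_mul_bet h, bet, div_le_div_iff₀ (by positivity) (by positivity)]
  push_cast
  have : (0 : ℝ) ≤ γ₀ * (2 * k ^ 2 + 26 * k + 64) := by positivity
  nlinarith

/-- The coefficient of `‖A x - b‖ ^ 2` in the one-step estimate. -/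
theorem eta_sub_coeff {γ₀ : ℝ} (h : 0 < γ₀) (k : ℕ) :
    eta γ₀ k - tau k ^ 2 / (2 * ((1 - tau k) * bet γ₀ k)) - eta γ₀ k ^ 2 / gam γ₀ (k + 1)
      = -(3 * γ₀ / (2 * (k + 3) * (k + 4))) := by
  rw [one_sub_tau_mul_bet h, gam_succ, eta, tau]
  field_simp
  ring

/-- The error 3γₖ·DA reproduces itself: its surplus after damping by 1 - τₖ is of order γ₀/k²,
enough for the leftover residual term and for the ρₖ² term. -/
theorem error_recursion {γ₀ : ℝ} (h : 0 < γ₀) (k : ℕ) :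
    (1 - tau k) * (3 * gam γ₀ k) + 3 * γ₀ / ((k + 3) * (k + 4))
      + 2 * rho γ₀ k ^ 2 / gam γ₀ (k + 1) ≤ 3 * gam γ₀ (k + 1) := by
  have hk : (0 : ℝ) ≤ k := k.cast_nonneg
  have e : 3 * gam γ₀ (k + 1) - ((1 - tau k) * (3 * gam γ₀ k) + 3 * γ₀ / ((k + 3) * (k + 4))
      + 2 * rho γ₀ k ^ 2 / gam γ₀ (k + 1))
      = γ₀ * (9 * k ^ 2 + 51 * k + 78) / ((k + 2) * (k + 3) * (k + 4) ^ 2) := by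
    rw [one_sub_tau, gam_succ, gam, rho]
    field_simp
    ring
  have : (0 : ℝ) ≤ γ₀ * (9 * k ^ 2 + 51 * k + 78) / ((k + 2) * (k + 3) * (k + 4) ^ 2) := by
    positivity
  linarith

end Parameters

/-! ### Estimates for one block step -/

/-- First-order optimality for a convex function plus two quadratics of a linear image. -/
theorem variational_inequality {E F : Type*} [AddCommGroup E] [Module ℝ E]
    [NormedAddCommGroup F] [InnerProductSpace ℝ F] {C : Set E} {φ : E → ℝ} (hφ : ConvexOn ℝ C φ)
    (A : E →ₗ[ℝ] F) (p q : F) (γ ρ : ℝ) {x : E} (hx : x ∈ C)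
    (hmin : ∀ u ∈ C, φ x + (γ / 2 * ‖A x - p‖ ^ 2 + ρ / 2 * ‖A x - q‖ ^ 2) ≤
      φ u + (γ / 2 * ‖A u - p‖ ^ 2 + ρ / 2 * ‖A u - q‖ ^ 2)) {u : E} (hu : u ∈ C) :
    φ x ≤ φ u + inner ℝ (γ • (A x - p) + ρ • (A x - q)) (A u - A x) := by
  set G : ℝ := inner ℝ (γ • (A x - p) + ρ • (A x - q)) (A u - A x) with hG
  set M : ℝ := (γ + ρ) / 2 * ‖A u - A x‖ ^ 2 with hM
  have hquad : ∀ (v : F) (t : ℝ), ‖v + t • (A u - A x)‖ ^ 2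
      = ‖v‖ ^ 2 + 2 * t * inner ℝ v (A u - A x) + t ^ 2 * ‖A u - A x‖ ^ 2 := by
    intro v t
    rw [norm_add_sq_real, norm_smul, inner_smul_right, mul_pow, Real.norm_eq_abs, sq_abs]
    ring
  -- Minimality is compared at (1 - t)x + tu, divided by t, and t → 0 removes the quadratic term t *
  -- M.
  have key : ∀ t : ℝ, 0 < t → t < 1 → 0 ≤ φ u - φ x + G + t * M := by
    intro t ht0 ht1
    have h1t : 0 ≤ 1 - t := by linarith
    have h1 := hmin _ (hφ.1 hx hu h1t ht0.le (by ring))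
    have h2 := hφ.2 hx hu h1t ht0.le (by ring)
    have e : ∀ w : F, A ((1 - t) • x + t • u) - w = (A x - w) + t • (A u - A x) := by
      intro w
      rw [map_add, map_smul, map_smul]
      module
    rw [e, e, hquad, hquad] at h1
    rw [inner_add_left, inner_smul_left, inner_smul_left] at hG
    simp only [smul_eq_mul, conj_trivial] at h2 hG
    have h3 : 0 ≤ t * (φ u - φ x + G + t * M) := by
      rw [hG, hM]
      linarith
    exact nonneg_of_mul_nonneg_right h3 ht0
  have hlim : Filter.Tendsto (fun t : ℝ => φ u - φ x + G + t * M) (nhdsWithin 0 (Set.Ioi 0))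
      (nhds (φ u - φ x + G + 0 * M)) :=
    Filter.Tendsto.mono_left (Continuous.tendsto (by fun_prop) 0) nhdsWithin_le_nhds
  have := ge_of_tendsto hlim (by
    filter_upwards [Ioo_mem_nhdsGT (zero_lt_one' ℝ)] with t ht using key t ht.1 ht.2)
  linarith

/-- A minimizer over `X` of `f` plus a real-valued function lies in the domain of `f`, if that
domain meets `X`, and it minimizes the real-valued sum. -/
theorem ProperClosedConvex.of_isMinOn {n : ℕ} {f : Vec n → EReal} (hf : ProperClosedConvex f)
    {X : Set (Vec n)} {q : Vec n → ℝ} {x z : Vec n} (hz : z ∈ X) (hzt : f z ≠ ⊤)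
    (hmin : IsMinOn (fun u => f u + (q u : EReal)) X x) :
    f x ≠ ⊤ ∧ ∀ u ∈ X ∩ {u | f u ≠ ⊤}, (f x).toReal + q x ≤ (f u).toReal + q u := by
  have hx : f x ≠ ⊤ := by
    intro h
    have h1 := hmin hz
    simp only [Set.mem_ofPred_eq] at h1
    rw [h, EReal.top_add_of_ne_bot (EReal.coe_ne_bot _), ← hf.coe_toReal hzt, ← EReal.coe_add,
      top_le_iff] at h1
    exact EReal.coe_ne_top _ h1
  refine ⟨hx, fun u hu => ?_⟩
  have h1 := hmin hu.1
  simp only [Set.mem_ofPred_eq] at h1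
  rwa [← hf.coe_toReal hx, ← hf.coe_toReal hu.2, ← EReal.coe_add, ← EReal.coe_add,
    EReal.coe_le_coe_iff] at h1

namespace Problem

variable {n₁ n₂ m : ℕ} {P : Problem n₁ n₂ m}

theorem norm_res_sq_le (hbdd : BddAbove ((fun x => ‖P.res x‖ ^ 2) '' P.X))
    {x : Vec n₁ × Vec n₂} (hx : x ∈ P.X) : ‖P.res x‖ ^ 2 ≤ 2 * P.DA := by
  have := le_csSup hbdd ⟨x, hx, rfl⟩
  rw [DA]
  simp only at this
  linarith

theorem DA_nonneg (P : Problem n₁ n₂ m) : 0 ≤ P.DA :=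
  mul_nonneg (by norm_num) (Real.sSup_nonneg (by rintro _ ⟨x, _, rfl⟩; positivity))

theorem D₁_nonneg (P : Problem n₁ n₂ m) (xc : Vec n₁) : 0 ≤ P.D₁ xc :=
  mul_nonneg (by norm_num) (Real.sSup_nonneg (by rintro _ ⟨x, _, rfl⟩; positivity))

/-- The supremum must be shown finite, since `sSup` of an unbounded set is 0. As A₁(u - xc) is a
difference of two residuals, the parallelogram law gives the bound 8·DA. -/
theorem half_norm_sq_le_D₁ (hP : P.Standing)
    (hbdd : BddAbove ((fun x => ‖P.res x‖ ^ 2) '' P.X)) {xc x₁ : Vec n₁} (hxc : xc ∈ P.X₁)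
    (hx₁ : x₁ ∈ P.X₁) : (1 / 2) * ‖P.A₁ (x₁ - xc)‖ ^ 2 ≤ P.D₁ xc := by
  obtain ⟨z, hz⟩ := hP.X_nonempty
  refine mul_le_mul_of_nonneg_left (le_csSup ⟨8 * P.DA, ?_⟩ ⟨x₁, hx₁, rfl⟩) (by norm_num)
  rintro _ ⟨u, hu, rfl⟩
  have h1 := norm_res_sq_le hbdd (x := (u, z.2)) ⟨hu, hz.2⟩
  have h2 := norm_res_sq_le hbdd (x := (xc, z.2)) ⟨hxc, hz.2⟩
  have e : P.A₁ (u - xc) = P.res (u, z.2) - P.res (xc, z.2) := by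
    simp only [res, map_sub]
    abel
  have h3 := parallelogram_law_with_norm ℝ (P.res (u, z.2)) (P.res (xc, z.2))
  simp only
  rw [e]
  nlinarith [norm_nonneg (P.res (u, z.2) + P.res (xc, z.2))]

end Problem

open Problem

variable {n₁ n₂ m : ℕ} {P : Problem n₁ n₂ m} {γ₀ : ℝ} {xc : Vec n₁}

theorem IsBlockStep.mem_X {k : ℕ} {yh y : Vec m} {z₂ : Vec n₂} {x : Vec n₁ × Vec n₂}
    (h : IsBlockStep P γ₀ xc k yh z₂ x y) : x ∈ P.X := ⟨h.mem₁, h.mem₂⟩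

/-- The block step as a lower bound of the smoothed Lagrangian at the new multiplier. -/
theorem IsBlockStep.lagrangian_bound (hP : P.Standing) (hγ : 0 < γ₀) {k : ℕ} {yh y : Vec m}
    {z₂ : Vec n₂} {x : Vec n₁ × Vec n₂} (h : IsBlockStep P γ₀ xc k yh z₂ x y) :
    x ∈ P.dom ∧ ∀ u ∈ P.X ∩ P.dom,
      P.realObj x + inner ℝ y (P.res x) + gam γ₀ (k + 1) / 2 * ‖P.A₁ (x.1 - xc)‖ ^ 2
        - (eta γ₀ k ^ 2 * ‖P.res x‖ ^ 2 + rho γ₀ k ^ 2 * ‖P.res (x.1, z₂)‖ ^ 2) / gam γ₀ (k + 1)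
      ≤ P.realObj u + inner ℝ y (P.res u) + gam γ₀ (k + 1) / 2 * ‖P.A₁ (u.1 - xc)‖ ^ 2 := by
  obtain ⟨z, hz, hzd, -⟩ := hP.exists_kuhnTucker
  obtain ⟨hd₁, hm₁⟩ := hP.f₁_pcc.of_isMinOn hz.1.1 hzd.1 h.min₁
  obtain ⟨hd₂, hm₂⟩ := hP.f₂_pcc.of_isMinOn hz.1.2 hzd.2 h.min₂
  refine ⟨⟨hd₁, hd₂⟩, fun u hu => ?_⟩
  set γ := gam γ₀ (k + 1) with hγdef
  set ρ := rho γ₀ k with hρdef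
  set η := eta γ₀ k with hηdef
  have hγ0 : 0 < γ := gam_pos hγ _
  have hρ0 : 0 < ρ := rho_pos hγ _
  have hη0 : 0 < η := eta_pos hγ _
  have c₁ : ConvexOn ℝ (P.X₁ ∩ {v | P.f₁ v ≠ ⊤}) (fun v => (P.f₁ v).toReal) :=
    hP.f₁_pcc.convexOn_toReal.subset Set.inter_subset_right
      (hP.X₁_convex.inter hP.f₁_pcc.convexOn_toReal.1)
  have c₂ : ConvexOn ℝ (P.X₂ ∩ {v | P.f₂ v ≠ ⊤}) (fun v => (P.f₂ v).toReal) :=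
    hP.f₂_pcc.convexOn_toReal.subset Set.inter_subset_right
      (hP.X₂_convex.inter hP.f₂_pcc.convexOn_toReal.1)
  have v₁ := variational_inequality c₁ P.A₁.toLinearMap (P.A₁ xc)
    (-(P.A₂ z₂ - P.b + ρ⁻¹ • yh)) γ ρ ⟨h.mem₁, hd₁⟩ (by
      intro v hv
      have := hm₁ v hv
      have e : ∀ w, P.A₁ w - -(P.A₂ z₂ - P.b + ρ⁻¹ • yh)
          = P.A₁ w + P.A₂ z₂ - P.b + ρ⁻¹ • yh := fun w => by abel
      simpa only [ContinuousLinearMap.coe_coe, e, ← map_sub] using this) ⟨hu.1.1, hu.2.1⟩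
  have v₂ := variational_inequality c₂ P.A₂.toLinearMap 0
    (-(P.A₁ x.1 - P.b + η⁻¹ • yh)) 0 η ⟨h.mem₂, hd₂⟩ (by
      intro v hv
      have := hm₂ v hv
      have e : ∀ w, P.A₂ w - -(P.A₁ x.1 - P.b + η⁻¹ • yh)
          = P.A₁ x.1 + P.A₂ w - P.b + η⁻¹ • yh := fun w => by abel
      simpa only [ContinuousLinearMap.coe_coe, e, zero_div, zero_mul, zero_add] using this)
    ⟨hu.1.2, hu.2.2⟩
  simp only [ContinuousLinearMap.coe_coe] at v₁ v₂
  set d₁ := P.A₁ u.1 - P.A₁ x.1 with hd₁def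
  set d₂ := P.A₂ u.2 - P.A₂ x.2 with hd₂def
  set r := P.res x with hr
  set q := P.res (x.1, z₂) with hq
  have hy : y = yh + η • r := h.dual_eq
  -- The first block sees the multiplier yh + ρ q instead of y = yh + η r; the second (`e₂`) sees y
  -- exactly. Only the discrepancy ρ q - η r remains.
  have e₁ : γ • (P.A₁ x.1 - P.A₁ xc) + ρ • (P.A₁ x.1 - -(P.A₂ z₂ - P.b + ρ⁻¹ • yh))
      = γ • (P.A₁ x.1 - P.A₁ xc) + (y + (ρ • q - η • r)) := by
    have : ρ • (P.A₁ x.1 - -(P.A₂ z₂ - P.b + ρ⁻¹ • yh)) = ρ • q + (ρ * ρ⁻¹) • yh := by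
      simp only [hq, res]
      module
    rw [this, mul_inv_cancel₀ hρ0.ne', hy]
    module
  have e₂ : (0 : ℝ) • (P.A₂ x.2 - 0) + η • (P.A₂ x.2 - -(P.A₁ x.1 - P.b + η⁻¹ • yh)) = y := by
    have : η • (P.A₂ x.2 - -(P.A₁ x.1 - P.b + η⁻¹ • yh)) = η • r + (η * η⁻¹) • yh := by
      simp only [hr, res]
      module
    rw [this, mul_inv_cancel₀ hη0.ne', hy]
    module
  have hru : P.res u = r + (d₁ + d₂) := by
    simp only [hr, res, hd₁def, hd₂def]
    abel
  have hsq : ‖P.A₁ (u.1 - xc)‖ ^ 2 = ‖P.A₁ (x.1 - xc)‖ ^ 2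
      + 2 * inner ℝ (P.A₁ x.1 - P.A₁ xc) d₁ + ‖d₁‖ ^ 2 := by
    have : P.A₁ (u.1 - xc) = P.A₁ (x.1 - xc) + d₁ := by
      simp only [map_sub, hd₁def]
      abel
    rw [this, norm_add_sq_real, map_sub]
  rw [e₁, inner_add_left, inner_add_left, inner_smul_left] at v₁
  rw [e₂] at v₂
  -- The discrepancy is paid for by the term (γ/2)‖d₁‖² in the expansion `hsq` of the proximal term.
  have young : inner ℝ (ρ • q - η • r) d₁ ≤ γ / 2 * ‖d₁‖ ^ 2
      + (η ^ 2 * ‖r‖ ^ 2 + ρ ^ 2 * ‖q‖ ^ 2) / γ := by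
    have h1 := real_inner_le_norm (ρ • q - η • r) d₁
    have h2 : ‖ρ • q - η • r‖ ^ 2 ≤ 2 * (η ^ 2 * ‖r‖ ^ 2 + ρ ^ 2 * ‖q‖ ^ 2) := by
      have h3 := parallelogram_law_with_norm ℝ (ρ • q) (η • r)
      have h4 : ‖ρ • q‖ ^ 2 = ρ ^ 2 * ‖q‖ ^ 2 := by
        rw [norm_smul, mul_pow, Real.norm_eq_abs, sq_abs]
      have h5 : ‖η • r‖ ^ 2 = η ^ 2 * ‖r‖ ^ 2 := by
        rw [norm_smul, mul_pow, Real.norm_eq_abs, sq_abs]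
      nlinarith [norm_nonneg (ρ • q + η • r)]
    have h6 : ‖ρ • q - η • r‖ * ‖d₁‖ ≤ γ / 2 * ‖d₁‖ ^ 2 + ‖ρ • q - η • r‖ ^ 2 / (2 * γ) := by
      have e : γ / 2 * ‖d₁‖ ^ 2 + ‖ρ • q - η • r‖ ^ 2 / (2 * γ) - ‖ρ • q - η • r‖ * ‖d₁‖
          = (γ * ‖d₁‖ - ‖ρ • q - η • r‖) ^ 2 / (2 * γ) := by
        field_simp
        ring
      have : 0 ≤ (γ * ‖d₁‖ - ‖ρ • q - η • r‖) ^ 2 / (2 * γ) := by positivity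
      linarith
    have h7 : ‖ρ • q - η • r‖ ^ 2 / (2 * γ) ≤ (η ^ 2 * ‖r‖ ^ 2 + ρ ^ 2 * ‖q‖ ^ 2) / γ := by
      rw [div_le_div_iff₀ (by positivity) hγ0]
      nlinarith
    linarith
  rw [hru, inner_add_right, inner_add_right, hsq]
  simp only [conj_trivial] at v₁
  simp only [realObj]
  linarith

end PADMM

/-! ### Induction on the smoothed gap -/

namespace PADMM

open Problem

variable {n₁ n₂ m : ℕ} {P : Problem n₁ n₂ m} {γ₀ : ℝ} {xc : Vec n₁}

theorem Problem.res_combo (P : Problem n₁ n₂ m) (x y : Vec n₁ × Vec n₂) {a b : ℝ}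
    (hab : a + b = 1) : P.res (a • x + b • y) = a • P.res x + b • P.res y := by
  simp only [← P.resAffine_apply]
  exact affineMap_add_smul _ _ _ hab

/-- The smoothed primal-dual gap at `(x, y)` is at most `e`: the quadratically penalized objective
at `x` is bounded by the smoothed dual function at `y` plus `e`. -/
def SmoothedGapLE (P : Problem n₁ n₂ m) (xc : Vec n₁) (β γ e : ℝ) (x : Vec n₁ × Vec n₂)
    (y : Vec m) : Prop :=
  ∀ u ∈ P.X ∩ P.dom, P.realObj x + 1 / (2 * β) * ‖P.res x‖ ^ 2 ≤
    P.realObj u + inner ℝ y (P.res u) + γ / 2 * ‖P.A₁ (u.1 - xc)‖ ^ 2 + e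

theorem IsRun.mem (hP : P.Standing) (hγ : 0 < γ₀) {x xb : ℕ → Vec n₁ × Vec n₂} {yh yb : ℕ → Vec m}
    (h : IsRun P γ₀ xc x xb yh yb) (k : ℕ) : xb k ∈ P.X ∩ P.dom := by
  induction k with
  | zero =>
    obtain ⟨z₂, hz₂, hs⟩ := h.start
    exact ⟨hs.mem_X, (hs.lagrangian_bound hP hγ).1⟩
  | succ k ih =>
    rw [h.xb_eq]
    exact (hP.convex_X.inter hP.convexOn_realObj.1) ih
      ⟨(h.step k).mem_X, ((h.step k).lagrangian_bound hP hγ).1⟩ (one_sub_tau_pos k).le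
      (tau_pos k).le (by ring)

theorem IsRun.snd_mem {x xb : ℕ → Vec n₁ × Vec n₂} {yh yb : ℕ → Vec m}
    (h : IsRun P γ₀ xc x xb yh yb) : ∀ k, (x k).2 ∈ P.X₂
  | 0 => h.init_mem
  | k + 1 => (h.step k).mem₂

/-- With multiplier 0 the new y is η₀ r, so ⟨y, r⟩ supplies (γ₀/3)‖r‖². After losing γ₀/6 to the
step error, this still covers the penalty coefficient 7γ₀/54. -/
theorem smoothedGapLE_start (hP : P.Standing)
    (hbdd : BddAbove ((fun x => ‖P.res x‖ ^ 2) '' P.X)) (hγ : 0 < γ₀) {x : Vec n₁ × Vec n₂}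
    {y : Vec m} {z₂ : Vec n₂} (hz₂ : z₂ ∈ P.X₂) (h : IsBlockStep P γ₀ xc 0 0 z₂ x y) :
    SmoothedGapLE P xc (bet γ₀ 0) (gam γ₀ 0) (3 * gam γ₀ 0 * P.DA) x y := by
  intro u hu
  have h1 := (h.lagrangian_bound hP hγ).2 u hu
  have hQ : ‖P.res (x.1, z₂)‖ ^ 2 ≤ 2 * P.DA := norm_res_sq_le hbdd ⟨h.mem₁, hz₂⟩
  have hy : inner ℝ y (P.res x) = eta γ₀ 0 * ‖P.res x‖ ^ 2 := by
    rw [h.dual_eq, zero_add, inner_smul_left, real_inner_self_eq_norm_sq]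
    rfl
  rw [hy] at h1
  have hN : 0 ≤ γ₀ * ‖P.res x‖ ^ 2 := by positivity
  have hp : 0 ≤ γ₀ * ‖P.A₁ (x.1 - xc)‖ ^ 2 := by positivity
  have hu' : 0 ≤ γ₀ * ‖P.A₁ (u.1 - xc)‖ ^ 2 := by positivity
  have hQ' := mul_le_mul_of_nonneg_left hQ hγ.le
  have hDA := mul_nonneg hγ.le P.DA_nonneg
  have e1 : (eta γ₀ 0 ^ 2 * ‖P.res x‖ ^ 2 + rho γ₀ 0 ^ 2 * ‖P.res (x.1, z₂)‖ ^ 2)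
      / gam γ₀ (0 + 1) = 1 / 6 * (γ₀ * ‖P.res x‖ ^ 2)
        + 3 / 32 * (γ₀ * ‖P.res (x.1, z₂)‖ ^ 2) := by
    rw [eta, rho, gam]
    push_cast
    field_simp
    ring
  have e2 : 1 / (2 * bet γ₀ 0) = 7 / 54 * γ₀ := by
    rw [bet]
    push_cast
    field_simp
    ring
  have e3 : gam γ₀ (0 + 1) = 2 / 3 * γ₀ := by
    rw [gam]
    push_cast
    ring
  have e4 : gam γ₀ 0 = γ₀ := by
    rw [gam]
    push_cast
    ring
  have e5 : eta γ₀ 0 = γ₀ / 3 := by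
    rw [eta]
    push_cast
    ring
  rw [e1, e3, e5] at h1
  rw [e2, e4]
  linarith

theorem smoothedGapLE_step (hP : P.Standing)
    (hbdd : BddAbove ((fun x => ‖P.res x‖ ^ 2) '' P.X)) (hγ : 0 < γ₀) {k : ℕ}
    {x xb xb' : Vec n₁ × Vec n₂} {yh yb yb' : Vec m} {z₂ : Vec n₂} (hz₂ : z₂ ∈ P.X₂)
    (hxb : xb ∈ P.X ∩ P.dom)
    (hyh : yh = (1 - tau k) • yb + (tau k * (bet γ₀ k)⁻¹) • P.res xb)
    (h : IsBlockStep P γ₀ xc k yh z₂ x yb') (hxb' : xb' = (1 - tau k) • xb + tau k • x)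
    (ih : SmoothedGapLE P xc (bet γ₀ k) (gam γ₀ k) (3 * gam γ₀ k * P.DA) xb yb) :
    SmoothedGapLE P xc (bet γ₀ (k + 1)) (gam γ₀ (k + 1)) (3 * gam γ₀ (k + 1) * P.DA) xb' yb' := by
  intro u hu
  obtain ⟨hxd, hb⟩ := h.lagrangian_bound hP hγ
  have h1 := hb u hu
  -- The old gap is tested at the new block iterate x, not at u.
  have h2 := mul_le_mul_of_nonneg_left (ih x ⟨h.mem_X, hxd⟩) (one_sub_tau_pos k).le
  have hQ : ‖P.res (x.1, z₂)‖ ^ 2 ≤ 2 * P.DA := norm_res_sq_le hbdd ⟨h.mem₁, hz₂⟩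
  have hN : ‖P.res x‖ ^ 2 ≤ 2 * P.DA := norm_res_sq_le hbdd h.mem_X
  have hconv : P.realObj xb' ≤ (1 - tau k) * P.realObj xb + tau k * P.realObj x := by
    rw [hxb']
    exact hP.convexOn_realObj.2 hxb.2 hxd (one_sub_tau_pos k).le (tau_pos k).le (by ring)
  have hy : inner ℝ yb' (P.res x) = (1 - tau k) * inner ℝ yb (P.res x)
      + tau k * (bet γ₀ k)⁻¹ * inner ℝ (P.res xb) (P.res x) + eta γ₀ k * ‖P.res x‖ ^ 2 := by
    rw [h.dual_eq, hyh, inner_add_left, inner_add_left, inner_smul_left, inner_smul_left,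
      inner_smul_left, real_inner_self_eq_norm_sq]
    rfl
  have hres : ‖P.res xb'‖ ^ 2 = (1 - tau k) ^ 2 * ‖P.res xb‖ ^ 2
      + 2 * (tau k * (1 - tau k)) * inner ℝ (P.res xb) (P.res x)
      + tau k ^ 2 * ‖P.res x‖ ^ 2 := by
    rw [hxb', P.res_combo _ _ (by ring), norm_add_sq_real, norm_smul, norm_smul, mul_pow, mul_pow,
      inner_smul_left, inner_smul_right, Real.norm_eq_abs, Real.norm_eq_abs, sq_abs, sq_abs]
    simp only [conj_trivial]
    ring
  have hτ := one_sub_tau_pos k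
  have hβ := bet_pos hγ k
  -- The cross term is exactly the one that the summand τ β⁻¹ r(xb) of yh contributes to ⟨yb',
  -- r(x)⟩.
  have hpen : 1 / (2 * bet γ₀ (k + 1)) * ‖P.res xb'‖ ^ 2
      ≤ (1 - tau k) * (1 / (2 * bet γ₀ k) * ‖P.res xb‖ ^ 2)
        + tau k * (bet γ₀ k)⁻¹ * inner ℝ (P.res xb) (P.res x)
        + tau k ^ 2 / (2 * ((1 - tau k) * bet γ₀ k)) * ‖P.res x‖ ^ 2 := by
    have h3 : 1 / (2 * bet γ₀ (k + 1)) ≤ 1 / (2 * ((1 - tau k) * bet γ₀ k)) :=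
      one_div_le_one_div_of_le (by positivity)
        (mul_le_mul_of_nonneg_left (one_sub_tau_mul_bet_le hγ k) two_pos.le)
    refine (mul_le_mul_of_nonneg_right h3 (by positivity)).trans (le_of_eq ?_)
    rw [hres]
    generalize 1 - tau k = σ at hτ
    field_simp
  have hcoef := congrArg (· * ‖P.res x‖ ^ 2) (eta_sub_coeff hγ k)
  have hgam := mul_le_mul_of_nonneg_right (one_sub_tau_mul_gam_le hγ k)
    (by positivity : 0 ≤ 1 / 2 * ‖P.A₁ (x.1 - xc)‖ ^ 2)
  have herr := mul_le_mul_of_nonneg_right (error_recursion hγ k) P.DA_nonneg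
  -- The net coefficient of ‖r(x)‖² is negative, so boundedness of the residual on X is needed here.
  have hN' : 3 * γ₀ / (2 * (k + 3) * (k + 4)) * ‖P.res x‖ ^ 2
      ≤ 3 * γ₀ / ((k + 3) * (k + 4)) * P.DA := by
    have := mul_le_mul_of_nonneg_left hN
      (by positivity : 0 ≤ 3 * γ₀ / (2 * ((k : ℝ) + 3) * (k + 4)))
    refine this.trans (le_of_eq ?_)
    field_simp
  have hg' := gam_pos hγ (k + 1)
  have hQ' : rho γ₀ k ^ 2 / gam γ₀ (k + 1) * ‖P.res (x.1, z₂)‖ ^ 2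
      ≤ rho γ₀ k ^ 2 / gam γ₀ (k + 1) * (2 * P.DA) :=
    mul_le_mul_of_nonneg_left hQ (by positivity)
  have hsplit : (eta γ₀ k ^ 2 * ‖P.res x‖ ^ 2 + rho γ₀ k ^ 2 * ‖P.res (x.1, z₂)‖ ^ 2)
      / gam γ₀ (k + 1) = eta γ₀ k ^ 2 / gam γ₀ (k + 1) * ‖P.res x‖ ^ 2
        + rho γ₀ k ^ 2 / gam γ₀ (k + 1) * ‖P.res (x.1, z₂)‖ ^ 2 := by ring
  rw [hsplit, hy] at h1
  have herr' : (1 - tau k) * (3 * gam γ₀ k * P.DA) + 3 * γ₀ / ((k + 3) * (k + 4)) * P.DA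
      + rho γ₀ k ^ 2 / gam γ₀ (k + 1) * (2 * P.DA) ≤ 3 * gam γ₀ (k + 1) * P.DA := by
    refine le_trans (le_of_eq ?_) herr
    ring
  linarith

theorem IsRun.smoothedGapLE (hP : P.Standing)
    (hbdd : BddAbove ((fun x => ‖P.res x‖ ^ 2) '' P.X)) (hγ : 0 < γ₀)
    {x xb : ℕ → Vec n₁ × Vec n₂} {yh yb : ℕ → Vec m} (h : IsRun P γ₀ xc x xb yh yb) (k : ℕ) :
    SmoothedGapLE P xc (bet γ₀ k) (gam γ₀ k) (3 * gam γ₀ k * P.DA) (xb k) (yb k) := by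
  induction k with
  | zero =>
    obtain ⟨z₂, hz₂, hs⟩ := h.start
    exact smoothedGapLE_start hP hbdd hγ hz₂ hs
  | succ k ih =>
    exact smoothedGapLE_step hP hbdd hγ (h.snd_mem k) (h.mem hP hγ k) (h.yh_eq k) (h.step k)
      (h.xb_eq k) ih

/-! ### Convergence rates -/

theorem bet_three_le (k : ℕ) : bet 3 k ≤ 3 / (k + 2) := by
  have hk : (0 : ℝ) ≤ k := k.cast_nonneg
  rw [bet, div_le_div_iff₀ (by positivity) (by positivity)]
  nlinarith

theorem gam_three (k : ℕ) : gam 3 k = 6 / (k + 2) := by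
  rw [gam]
  norm_num

/-- A quadratic inequality `r² / (2 β) ≤ d r + s` with `β ≤ 3 / t` and `s ≤ 6 c / t` bounds `r`. -/
theorem le_of_sq_le {r β d s c t : ℝ} (hβ : 0 < β) (hd : 0 ≤ d) (ht : 0 < t) (hc : 0 ≤ c)
    (hβt : β ≤ 3 / t) (hs : s ≤ 6 * c / t) (hr : 0 ≤ r)
    (h : 1 / (2 * β) * r ^ 2 ≤ d * r + s) : r ≤ 6 * (d + √c) / t := by
  have hsq : √c ^ 2 = c := Real.sq_sqrt hc
  have hs0 : 0 ≤ √c := Real.sqrt_nonneg c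
  have h1 : r ^ 2 ≤ 2 * β * (d * r + 6 * c / t) := by
    have := mul_le_mul_of_nonneg_left (h.trans (by linarith : d * r + s ≤ d * r + 6 * c / t))
      (by positivity : 0 ≤ 2 * β)
    have e : 2 * β * (1 / (2 * β) * r ^ 2) = r ^ 2 := by field_simp
    linarith
  have h2 : r ^ 2 ≤ 2 * (3 / t) * (d * r + 6 * c / t) :=
    h1.trans (mul_le_mul_of_nonneg_right (by linarith) (by positivity))
  -- For s = t r this reads s² ≤ 6ds + 36c, whose larger root 3d + √(9d² + 36c) is at most 6(d +
  -- √c).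
  have h3 : (t * r) ^ 2 ≤ 6 * d * (t * r) + (6 * √c) ^ 2 := by
    have := mul_le_mul_of_nonneg_left h2 (by positivity : 0 ≤ t ^ 2)
    have e : t ^ 2 * (2 * (3 / t) * (d * r + 6 * c / t)) = 6 * d * (t * r) + 36 * c := by
      field_simp
      ring
    rw [e] at this
    rw [mul_pow, mul_pow, hsq]
    linarith
  rw [le_div_iff₀ ht]
  by_contra! hlt
  nlinarith [mul_nonneg hd hs0, mul_pos ht ht]

end PADMM

open PADMM PADMM.Problem in
theorem corollary6p1 {n₁ n₂ m : ℕ} (P : PADMM.Problem n₁ n₂ m) (hP : P.Standing)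
    (hbdd : BddAbove ((fun x => ‖P.res x‖ ^ 2) '' P.X))
    (xc : PADMM.Vec n₁) (x xb : ℕ → PADMM.Vec n₁ × PADMM.Vec n₂) (yh yb : ℕ → PADMM.Vec m)
    (hrun : PADMM.IsRun P 3 xc x xb yh yb) :
    ∃ fstar DY : ℝ, P.optVal = (fstar : EReal) ∧
      IsLeast ((fun y => ‖y‖) '' P.dualSolutions) DY ∧
      (∀ k : ℕ, ∃ v : ℝ, P.obj (xb k) = (v : EReal) ∧
        |v - fstar| ≤ 6 * P.Dmax xc DY / (k + 2) ∧
        ‖P.res (xb k)‖ ≤ 6 * (DY + √(P.D₁ xc + 4 * P.DA)) / (k + 2)) ∧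
      (∀ ε : ℝ, 0 < ε → ∀ k : ℕ,
        12 * max (P.Dmax xc DY) (DY + √(P.D₁ xc + 4 * P.DA)) / ε ≤ k + 2 →
        P.IsApproxPrimalDual ε (xb k) (yb k)) := by
  obtain ⟨z, hz, hzd, hopt, hdual, y, hy, hKT⟩ := hP.exists_isLeast_dualSolutions
  set R : ℝ := ‖y‖ + √(P.D₁ xc + 4 * P.DA) with hR
  have hDA := P.DA_nonneg
  have hD₁ := P.D₁_nonneg xc
  have lower : ∀ k, P.realObj z ≤ P.realObj (xb k) + ‖y‖ * ‖P.res (xb k)‖ := fun k =>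
    (hKT _ (hrun.mem hP three_pos k)).trans
      (add_le_add_right (real_inner_le_norm y (P.res (xb k))) _)
  have gap : ∀ k : ℕ, ∀ u ∈ P.X ∩ P.dom,
      P.realObj (xb k) + 1 / (2 * bet 3 k) * ‖P.res (xb k)‖ ^ 2
        ≤ P.realObj u + inner ℝ (yb k) (P.res u) + 6 * (P.D₁ xc + 3 * P.DA) / (k + 2) := by
    intro k u hu
    have h1 := hrun.smoothedGapLE hP hbdd three_pos k u hu
    have h2 := mul_le_mul_of_nonneg_left
      (half_norm_sq_le_D₁ hP hbdd hrun.center_mem hu.1.1) (gam_pos three_pos k).le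
    have e : gam 3 k * P.D₁ xc + 3 * gam 3 k * P.DA
        = 6 * (P.D₁ xc + 3 * P.DA) / (k + 2) := by
      rw [gam_three]
      ring
    linarith
  have upper : ∀ k : ℕ, P.realObj (xb k) + 1 / (2 * bet 3 k) * ‖P.res (xb k)‖ ^ 2
      ≤ P.realObj z + 6 * (P.D₁ xc + 3 * P.DA) / (k + 2) := by
    intro k
    have := gap k z ⟨hz.1, hzd⟩
    rwa [hz.2, inner_zero_right, add_zero] at this
  have hpen : ∀ k : ℕ, 0 ≤ 1 / (2 * bet 3 k) * ‖P.res (xb k)‖ ^ 2 := fun k => by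
    have := bet_pos three_pos k
    positivity
  have hres : ∀ k : ℕ, ‖P.res (xb k)‖ ≤ 6 * R / (k + 2) := by
    intro k
    -- Applied with c = D₁ + 4·DA, although the gap gives the smaller D₁ + 3·DA.
    refine le_of_sq_le (bet_pos three_pos k) (norm_nonneg y) (by positivity) (by positivity)
      (bet_three_le k) ?_ (norm_nonneg _)
      (by linarith [upper k, lower k] :
        _ ≤ ‖y‖ * ‖P.res (xb k)‖ + 6 * (P.D₁ xc + 3 * P.DA) / (k + 2))
    gcongr
    norm_num
  have hyres : ∀ k : ℕ, ‖y‖ * ‖P.res (xb k)‖ ≤ 6 * P.Dmax xc ‖y‖ / (k + 2) := by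
    intro k
    refine (mul_le_mul_of_nonneg_left (hres k) (norm_nonneg y)).trans ?_
    have : ‖y‖ * R ≤ P.Dmax xc ‖y‖ := le_max_right _ _
    rw [← mul_div_assoc, mul_left_comm]
    gcongr
  have hsm : ∀ k : ℕ, 6 * (P.D₁ xc + 3 * P.DA) / (k + 2) ≤ 6 * P.Dmax xc ‖y‖ / (k + 2) := by
    intro k
    gcongr
    exact le_max_left _ _
  have habs : ∀ k : ℕ, |P.realObj (xb k) - P.realObj z| ≤ 6 * P.Dmax xc ‖y‖ / (k + 2) := by
    intro k
    rw [abs_le]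
    constructor
    · linarith [lower k, hyres k]
    · linarith [upper k, hpen k, hsm k]
  refine ⟨P.realObj z, ‖y‖, hopt, hy, fun k =>
    ⟨P.realObj (xb k), hP.obj_eq (hrun.mem hP three_pos k).2, habs k, hres k⟩, ?_⟩
  intro ε hε k hk
  have hk2 : (0 : ℝ) < k + 2 := by positivity
  rw [div_le_iff₀ hε] at hk
  have hmax : 6 * P.Dmax xc ‖y‖ / (k + 2) ≤ ε / 2 := by
    rw [div_le_iff₀ hk2]
    linarith [le_max_left (P.Dmax xc ‖y‖) R]
  have hRε : 6 * R / (k + 2) ≤ ε / 2 := by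
    rw [div_le_iff₀ hk2]
    linarith [le_max_right (P.Dmax xc ‖y‖) R]
  have hmem := hrun.mem hP three_pos k
  refine ⟨⟨hmem.1, ⟨_, _, hP.obj_eq hmem.2, hopt, by linarith [habs k]⟩, by linarith [hres k]⟩, ?_⟩
  -- The dual loss is at most the gap error plus ‖y‖‖r(x̄ᵏ)‖, each bounded by 6·Dmax/(k + 2) ≤ ε/2;
  -- hence the constant 12.
  have hge : ((P.realObj z - ε : ℝ) : EReal) ≤ P.dual (yb k) :=
    hP.le_dual_iff.2 fun u hu => by
      linarith [gap k u hu, lower k, hyres k, hsm k, hpen k]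
  have hle := hP.dual_le hz hzd (yb k)
  have hv : ((P.dual (yb k)).toReal : EReal) = P.dual (yb k) :=
    EReal.coe_toReal (ne_top_of_le_ne_top (EReal.coe_ne_top _) hle)
      (ne_bot_of_le_ne_bot (EReal.coe_ne_bot _) hge)
  refine ⟨_, _, hv.symm, hdual, ?_⟩
  rw [← hv, EReal.coe_le_coe_iff] at hge hle
  rw [abs_le]
  constructor <;> linarith
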